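/- Let $\alpha>0$. For $n=0,1,2,\ldots$ and $t>0$ let $$D_n(t)=\det\left(\int_{-1}^{1}x^{i+j}(1-x^2)^{\alpha}e^{-t/(1-x^2)}\,dx\right)_{i,j=0}^{n-1},\qquad \sigma_n(t)=2t\frac{d}{dt}\ln D_n(t),$$ and, for $\beta>-1$, let $$\tilde D_n(t,\alpha,\beta)=\det\left(\int_{0}^{1}x^{i+j}\,x^{\alpha}(1-x)^{\beta}e^{-t/x}\,dx\right)_{i,j=0}^{n-1},\qquad \tilde H_n(t,\alpha,\beta)=t\frac{d}{dt}\ln \tilde D_n(t,\alpha,\beta)-n(n+\alpha+\beta),$$ with $D_0=\tilde D_0=1$. The determinants are positive and differentiable in $t>0$, and for all integers $n\ge 0$ and all $t>0$ $$\sigma_{2n}(t)=2\tilde H_n\left(t,\alpha,\tfrac12\right)+2\tilde H_n\left(t,\alpha,-\tfrac12\right)+4n(n+\alpha),$$ $$\sigma_{2n+1}(t)=2\tilde H_n\left(t,\alpha,\tfrac12\right)+2\tilde H_{n+1}\left(t,\alpha,-\tfrac12\right)+(2n+1)(2n+1+2\alpha).$$ Moreover, for every $\beta>-1$ and every integer $n\ge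 0$, the function $\tilde H_n=\tilde H_n(\cdot,\alpha,\beta)$ is twice continuously differentiable on $(0,\infty)$ and satisfies there the Jimbo–Miwa–Okamoto $\sigma$-form of Painlevé V, $$(t\tilde H_n'')^2=\left[\tilde H_n-t\tilde H_n'+2(\tilde H_n')^2+(\nu_0+\nu_1+\nu_2+\nu_3)\tilde H_n'\right]^2-4(\nu_0+\tilde H_n')(\nu_1+\tilde H_n')(\nu_2+\tilde H_n')(\nu_3+\tilde H_n'),$$ where $'=d/dt$ and $\nu_0=0,\ \nu_1=-(n+\alpha+\beta),\ \nu_2=n,\ \nu_3=-\beta$. -/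

import Mathlib

noncomputable section

namespace PollaczekJacobi

/-- The symmetric weight `w(x,t) = (1 - x²)^α exp(-t / (1 - x²))` on `[-1, 1]`. -/
def symWeight (α t x : ℝ) : ℝ :=
  (1 - x ^ 2) ^ α * Real.exp (-t / (1 - x ^ 2))

/-- The moments `μ_k(t)` of the symmetric weight over `[-1, 1]`. -/
def symMoment (α : ℝ) (k : ℕ) (t : ℝ) : ℝ :=
  ∫ x in (-1 : ℝ)..1, x ^ k * symWeight α t x

/-- The Hankel determinant `D_n(t) = det (μ_{i+j}(t))_{i,j=0}^{n-1}`, with `D_0 = 1`. -/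
def symHankel (α : ℝ) (n : ℕ) (t : ℝ) : ℝ :=
  (Matrix.of fun i j : Fin n => symMoment α (i + j) t).det

/-- `σ_n(t) = 2 t (d/dt) log D_n(t)`. -/
def sigma (α : ℝ) (n : ℕ) (t : ℝ) : ℝ :=
  2 * t * deriv (fun s => Real.log (symHankel α n s)) t

/-- The Pollaczek-Jacobi type weight `x^α (1 - x)^β exp(-t / x)` on `[0, 1]`. -/
def pjWeight (α β t x : ℝ) : ℝ :=
  x ^ α * (1 - x) ^ β * Real.exp (-t / x)

/-- The moments of the Pollaczek-Jacobi type weight over `[0, 1]`. -/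
def pjMoment (α β : ℝ) (k : ℕ) (t : ℝ) : ℝ :=
  ∫ x in (0 : ℝ)..1, x ^ k * pjWeight α β t x

/-- The Hankel determinant of the Pollaczek-Jacobi type weight (equal to `1` for `n = 0`). -/
def pjHankel (α β : ℝ) (n : ℕ) (t : ℝ) : ℝ :=
  (Matrix.of fun i j : Fin n => pjMoment α β (i + j) t).det

/-- `H̃_n(t, α, β)`: the logarithmic derivative `t (d/dt) log` of the Hankel determinant of
the Pollaczek-Jacobi type weight, shifted by the constant `n (n + α + β)`. -/
def Htilde (n : ℕ) (t α β : ℝ) : ℝ :=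
  t * deriv (fun s => Real.log (pjHankel α β n s)) t - n * (n + α + β)

/-- `H` is a (twice continuously differentiable) solution on `(0, ∞)` of the
Jimbo-Miwa-Okamoto σ-form of Painlevé V with parameters `ν₀, ν₁, ν₂, ν₃`. -/
def IsSigmaPainleveV (ν₀ ν₁ ν₂ ν₃ : ℝ) (H : ℝ → ℝ) : Prop :=
  ContDiffOn ℝ 2 H (Set.Ioi 0) ∧
  ∀ t : ℝ, 0 < t →
    (t * deriv (deriv H) t) ^ 2 =
      (H t - t * deriv H t + 2 * (deriv H t) ^ 2
          + (ν₀ + ν₁ + ν₂ + ν₃) * deriv H t) ^ 2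
        - 4 * (ν₀ + deriv H t) * (ν₁ + deriv H t) * (ν₂ + deriv H t) * (ν₃ + deriv H t)

end PollaczekJacobi

end

/-! Painlevé V. Put y = 1/x. Reversing the index order turns the n × n Hankel matrix into that of
the y-moments of v = y^(-c) (y-1)^β exp(-ty) on (1, ∞), with c = 2n + α + β. This weight evolves by
a Toda flow (`IsTodaFlow`) and has v'/v = -c/y + β/(y-1) - t (`Pearson`).

Let P_n be the monic orthogonal polynomials, h_n their norms, a_n the diagonal recurrence
coefficients, and p the coefficient of y^(n-1) in P_n. The Toda flow gives (log det)' = p, p' = b =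
h_n/h_{n-1} and b' = b (a_{n-1} - a_n). So H̃ = tp - n(n+α+β), r = H̃' = p + tb and tH̃'' = 2tb +
t²b(a_{n-1} - a_n).

At each pole 0, 1 of v'/v, orthogonality gives one quadratic relation between residues
(`residue_identity`): b ρ ρ' = r(r-β) and b(t-ρ)(t-ρ') = (r+n)(r+n-c), where ρ, ρ' are the
normalised residues at 1 of P_n², P_{n-1}². For u = b(t-ρ)ρ' and w = bρ(t-ρ'), the difference u-w is
tH̃'', the sum u+w is minus the bracket of the σ-form, and uw is its quartic product. The σ-form is
(u-w)² = (u+w)² - 4uw (`sigma_form_algebraic`).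

Symmetric weight. Odd moments vanish, so even and odd indices decouple; the substitution x = 1 - u²
identifies the two blocks with β = -1/2 and β = 1/2 (`symHankel_eq_mul`). -/

namespace PollaczekJacobi

open Polynomial

/-! ### Monic orthogonal polynomials, Hankel determinants, residue identity -/

/-- The linear functional on real polynomials with moments `m k`. -/
noncomputable def momentFunctional (m : ℕ → ℝ) : ℝ[X] →ₗ[ℝ] ℝ :=
  Polynomial.lsum fun k => m k • LinearMap.id

theorem momentFunctional_eq_sum_range (m : ℕ → ℝ) {q : ℝ[X]} {N : ℕ} (hq : q.natDegree < N) :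
    momentFunctional m q = ∑ k ∈ Finset.range N, q.coeff k * m k := by
  simp only [momentFunctional, Polynomial.lsum_apply]
  rw [Polynomial.sum_over_range' _ (by simp) N hq]
  simp [mul_comm]

theorem momentFunctional_X_pow (m : ℕ → ℝ) (k : ℕ) : momentFunctional m (X ^ k) = m k := by
  rw [momentFunctional_eq_sum_range m (N := k + 1) (by simp)]
  simp [Polynomial.coeff_X_pow]

/-- A linear functional on polynomials is positive definite if `L (q ^ 2) > 0` for `q ≠ 0`. -/
def IsPosDef (L : ℝ[X] →ₗ[ℝ] ℝ) : Prop := ∀ q : ℝ[X], q ≠ 0 → 0 < L (q * q)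

/-- Monic orthogonal polynomials of `L`, through the three-term recurrence. -/
noncomputable def orthoPoly (L : ℝ[X] →ₗ[ℝ] ℝ) : ℕ → ℝ[X]
  | 0 => 1
  | 1 => X - C (L (X * (1 * 1)) / L (1 * 1))
  | n + 2 =>
    (X - C (L (X * (orthoPoly L (n + 1) * orthoPoly L (n + 1))) /
        L (orthoPoly L (n + 1) * orthoPoly L (n + 1)))) * orthoPoly L (n + 1)
      - C (L (orthoPoly L (n + 1) * orthoPoly L (n + 1)) / L (orthoPoly L n * orthoPoly L n))
        * orthoPoly L n

/-- The squared norm `h_n = L (P_n ^ 2)`. -/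
noncomputable def opNorm (L : ℝ[X] →ₗ[ℝ] ℝ) (n : ℕ) : ℝ := L (orthoPoly L n * orthoPoly L n)

/-- The diagonal recurrence coefficient `a_n = L (X P_n ^ 2) / h_n`. -/
noncomputable def opDiag (L : ℝ[X] →ₗ[ℝ] ℝ) (n : ℕ) : ℝ :=
  L (X * (orthoPoly L n * orthoPoly L n)) / opNorm L n

variable (L : ℝ[X] →ₗ[ℝ] ℝ)

theorem orthoPoly_zero : orthoPoly L 0 = 1 := by simp [orthoPoly]

theorem orthoPoly_one : orthoPoly L 1 = X - C (opDiag L 0) := by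
  simp [orthoPoly, opDiag, opNorm]

theorem orthoPoly_add_two (n : ℕ) :
    orthoPoly L (n + 2) = (X - C (opDiag L (n + 1))) * orthoPoly L (n + 1)
      - C (opNorm L (n + 1) / opNorm L n) * orthoPoly L n := by
  rw [orthoPoly]; rfl

/-- No positivity is needed: a division by zero in the recurrence spoils orthogonality but not the
leading term. Degree bounds therefore hold at every parameter value, also for t ≤ 0. -/
theorem orthoPoly_monic_natDegree (n : ℕ) :
    (orthoPoly L n).Monic ∧ (orthoPoly L n).natDegree = n := by
  induction n using Nat.strong_induction_on with
  | _ n ih =>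
    match n, ih with
    | 0, _ => simp [orthoPoly_zero]
    | 1, _ => rw [orthoPoly_one]; exact ⟨monic_X_sub_C _, natDegree_X_sub_C _⟩
    | n + 2, ih =>
      obtain ⟨h1, d1⟩ := ih (n + 1) (by omega)
      obtain ⟨h0, d0⟩ := ih n (by omega)
      have hm : ((X - C (opDiag L (n + 1))) * orthoPoly L (n + 1)).Monic :=
        (monic_X_sub_C _).mul h1
      have hd : ((X - C (opDiag L (n + 1))) * orthoPoly L (n + 1)).natDegree = n + 2 := by
        rw [(monic_X_sub_C _).natDegree_mul h1, natDegree_X_sub_C, d1]; omega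
      have hlt : (C (opNorm L (n + 1) / opNorm L n) * orthoPoly L n).natDegree <
          ((X - C (opDiag L (n + 1))) * orthoPoly L (n + 1)).natDegree := by
        have := natDegree_C_mul_le (opNorm L (n + 1) / opNorm L n) (orthoPoly L n)
        omega
      rw [orthoPoly_add_two]
      exact ⟨hm.sub_of_left (degree_lt_degree hlt),
        by rw [natDegree_sub_eq_left_of_natDegree_lt hlt, hd]⟩

/-- `P` is monic of degree `n` and `L`-orthogonal to all polynomials of lower degree. -/
structure IsMonicOrtho (L : ℝ[X] →ₗ[ℝ] ℝ) (n : ℕ) (P : ℝ[X]) : Prop where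
  monic : P.Monic
  natDegree : P.natDegree = n
  ortho : ∀ q : ℝ[X], q.degree < n → L (P * q) = 0

variable {L}

theorem IsMonicOrtho.coeff_self {n : ℕ} {P : ℝ[X]} (hP : IsMonicOrtho L n P) :
    P.coeff n = 1 := by
  have := hP.monic.coeff_natDegree
  rwa [hP.natDegree] at this

theorem IsMonicOrtho.coeff_eq_zero {n : ℕ} {P : ℝ[X]} (hP : IsMonicOrtho L n P) {k : ℕ}
    (hk : n < k) : P.coeff k = 0 :=
  coeff_eq_zero_of_natDegree_lt (by rw [hP.natDegree]; exact hk)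

theorem IsMonicOrtho.degree {n : ℕ} {P : ℝ[X]} (hP : IsMonicOrtho L n P) :
    P.degree = n := by
  rw [degree_eq_natDegree hP.monic.ne_zero, hP.natDegree]

theorem IsMonicOrtho.sub_degree_lt {n : ℕ} {P : ℝ[X]} (hP : IsMonicOrtho L n P) {q : ℝ[X]}
    (hq : q.degree < (n + 1 : ℕ)) : (q - C (q.coeff n) * P).degree < n := by
  rw [degree_lt_iff_coeff_zero] at hq ⊢
  intro k hk
  rcases hk.eq_or_lt with rfl | hk
  · simp [hP.coeff_self]
  · simp [hP.coeff_eq_zero hk, hq k hk]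

theorem IsMonicOrtho.apply_mul {n : ℕ} {P : ℝ[X]} (hP : IsMonicOrtho L n P) {q : ℝ[X]}
    (hq : q.degree < (n + 1 : ℕ)) : L (P * q) = q.coeff n * L (P * P) := by
  have h := hP.ortho _ (hP.sub_degree_lt hq)
  rw [mul_sub, map_sub, sub_eq_zero] at h
  rw [h, mul_left_comm, ← smul_eq_C_mul, map_smul, smul_eq_mul]

theorem degree_X_mul_lt {q : ℝ[X]} {n : ℕ} (hq : q.degree < n) :
    (X * q : ℝ[X]).degree < ((n + 1 : ℕ) : WithBot ℕ) := by
  rw [degree_lt_iff_coeff_zero] at hq ⊢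
  intro k hk
  obtain ⟨k, rfl⟩ : ∃ j, k = j + 1 := ⟨k - 1, by omega⟩
  rw [coeff_X_mul]
  exact hq k (by omega)

theorem isMonicOrtho_orthoPoly (hL : IsPosDef L) (n : ℕ) : IsMonicOrtho L n (orthoPoly L n) := by
  have hpos : ∀ k, opNorm L k ≠ 0 := fun k =>
    (hL _ (orthoPoly_monic_natDegree L k).1.ne_zero).ne'
  induction n using Nat.strong_induction_on with
  | _ n ih =>
    refine ⟨(orthoPoly_monic_natDegree L n).1, (orthoPoly_monic_natDegree L n).2, ?_⟩
    intro q hq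
    match n, ih, hq with
    | 0, _, hq =>
      have : q = 0 := by simpa [degree_lt_iff_coeff_zero, Polynomial.ext_iff] using hq
      simp [this]
    | 1, ih, hq =>
      have h0 := ih 0 (by omega)
      have hq' : q = C (q.coeff 0) := by
        rw [degree_lt_iff_coeff_zero] at hq
        ext k
        rcases k with _ | k
        · simp
        · rw [hq _ (by omega), coeff_C_succ]
      have h1 : opDiag L 0 * L 1 = L X := by
        have := hpos 0
        simp only [opDiag, opNorm, orthoPoly_zero, mul_one] at this ⊢
        field_simp
      rw [hq', orthoPoly_one, mul_comm, ← smul_eq_C_mul, map_smul, map_sub, ← h1]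
      rw [← mul_one (C (opDiag L 0)), ← smul_eq_C_mul, map_smul]
      simp
    | n + 2, ih, hq =>
      have h1 := ih (n + 1) (by omega)
      have h0 := ih n (by omega)
      have key : ∀ q, L (orthoPoly L (n + 2) * q) = L (orthoPoly L (n + 1) * (X * q))
          - opDiag L (n + 1) * L (orthoPoly L (n + 1) * q)
          - opNorm L (n + 1) / opNorm L n * L (orthoPoly L n * q) := by
        intro q
        rw [orthoPoly_add_two, ← smul_eq_mul (opDiag L (n + 1)), ← map_smul,
          ← smul_eq_mul (_ / _), ← map_smul, ← map_sub, ← map_sub, smul_eq_C_mul, smul_eq_C_mul]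
        congr 1
        ring
      -- Split q into a part of degree < n and multiples of P_n and P_{n+1}. The first is killed by
      -- all three terms of the recurrence; on the other two the recurrence coefficients are the
      -- ones that cancel.
      have hq1 := h1.sub_degree_lt hq
      have hq0 := h0.sub_degree_lt hq1
      set q1 := q - C (q.coeff (n + 1)) * orthoPoly L (n + 1) with hq1d
      set q0 := q1 - C (q1.coeff n) * orthoPoly L n with hq0d
      have hdec : q = q0 + C (q1.coeff n) * orthoPoly L n
          + C (q.coeff (n + 1)) * orthoPoly L (n + 1) := by
        rw [hq0d, hq1d]; ring
      have e0 : L (orthoPoly L (n + 2) * q0) = 0 := by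
        rw [key, h1.ortho _ (degree_X_mul_lt hq0), h0.ortho _ hq0,
          h1.ortho _ (hq0.trans (by exact_mod_cast Nat.lt_succ_self n))]
        simp
      have hd0 : (orthoPoly L n).degree < (n + 1 : ℕ) := by
        rw [h0.degree]; exact_mod_cast Nat.lt_succ_self n
      have e1 : L (orthoPoly L (n + 2) * orthoPoly L n) = 0 := by
        rw [key, h1.ortho _ hd0, h1.apply_mul (degree_X_mul_lt hd0), coeff_X_mul, h0.coeff_self]
        have := hpos n
        simp only [opNorm] at this ⊢
        field_simp
        ring
      have e2 : L (orthoPoly L (n + 2) * orthoPoly L (n + 1)) = 0 := by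
        rw [key, mul_comm (orthoPoly L n), h1.ortho _ hd0, mul_left_comm]
        have := hpos (n + 1)
        simp only [opDiag, opNorm] at this ⊢
        field_simp
        ring
      rw [hdec, mul_add, mul_add, map_add, map_add, mul_left_comm, ← smul_eq_C_mul, map_smul,
        mul_left_comm, ← smul_eq_C_mul, map_smul, e0, e1, e2]
      simp

/-- The Gram determinant of monic polynomials of degrees `0, 1, …` is the Hankel determinant. -/
theorem det_gram_eq_det_hankel (m : ℕ → ℝ) (n : ℕ) (P : ℕ → ℝ[X]) (hP : ∀ i, (P i).Monic)
    (hd : ∀ i, (P i).natDegree = i) :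
    (Matrix.of fun i j : Fin n => momentFunctional m (P i * P j)).det =
      (Matrix.of fun i j : Fin n => m (i + j)).det := by
  have hC := Matrix.det_matrixOfPolynomials (fun i : Fin n => P i) (fun i => hd i) (fun i => hP i)
  set A := Matrix.of fun i j : Fin n => (P j).coeff i with hA
  have hsum : ∀ i : Fin n, P i = ∑ k : Fin n, C ((P i).coeff k) * X ^ (k : ℕ) := by
    intro i
    rw [Fin.sum_univ_eq_sum_range (fun k => C ((P i).coeff k) * X ^ k) n]
    exact as_sum_range_C_mul_X_pow' _ (by rw [hd]; exact i.2)
  have : (Matrix.of fun i j : Fin n => momentFunctional m (P i * P j)) =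
      A.transpose * (Matrix.of fun i j : Fin n => m (i + j)) * A := by
    ext i j
    rw [Matrix.of_apply, hsum i, hsum j, Finset.sum_mul_sum, Finset.sum_comm]
    simp only [Matrix.mul_apply, Matrix.transpose_apply, hA, Matrix.of_apply, map_sum,
      Finset.sum_mul]
    refine Finset.sum_congr rfl fun l _ => Finset.sum_congr rfl fun k _ => ?_
    rw [← momentFunctional_X_pow m, pow_add,
      show C ((P i).coeff k) * X ^ (k : ℕ) * (C ((P j).coeff l) * X ^ (l : ℕ)) =
        ((P i).coeff k * (P j).coeff l) • (X ^ (k : ℕ) * X ^ (l : ℕ)) by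
          rw [smul_eq_C_mul, C_mul]; ring, map_smul, smul_eq_mul]
    ring
  rw [this, Matrix.det_mul, Matrix.det_mul, Matrix.det_transpose, hC]
  simp

theorem det_hankel_eq_prod (m : ℕ → ℝ) (hm : IsPosDef (momentFunctional m)) (n : ℕ) :
    (Matrix.of fun i j : Fin n => m (i + j)).det =
      ∏ j ∈ Finset.range n, opNorm (momentFunctional m) j := by
  rw [← det_gram_eq_det_hankel m n (orthoPoly (momentFunctional m))
    (fun i => (orthoPoly_monic_natDegree _ i).1) (fun i => (orthoPoly_monic_natDegree _ i).2),
    ← Fin.prod_univ_eq_prod_range, ← Matrix.det_diagonal]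
  congr 1
  ext i j
  rw [Matrix.of_apply, Matrix.diagonal_apply]
  split_ifs with h
  · rw [h, opNorm]
  · rcases Nat.lt_or_gt_of_ne (Fin.val_ne_of_ne h) with h | h
    · rw [mul_comm]
      refine (isMonicOrtho_orthoPoly hm j).ortho _ ?_
      rw [(isMonicOrtho_orthoPoly hm i).degree]; exact_mod_cast h
    · refine (isMonicOrtho_orthoPoly hm i).ortho _ ?_
      rw [(isMonicOrtho_orthoPoly hm j).degree]; exact_mod_cast h

/-- The determinant of the residue matrix of the ladder operators at `z` vanishes. -/
theorem residue_identity {Λ : ℝ[X] →ₗ[ℝ] ℝ} {z κ : ℝ}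
    (hΛ : ∀ q, Λ ((X - C z) * q) = κ * L q) {n : ℕ} {P Q : ℝ[X]}
    (hP : IsMonicOrtho L (n + 1) P) (hQ : IsMonicOrtho L n Q) :
    Λ (P * P) * Λ (Q * Q) = Λ (P * Q) * (Λ (P * Q) - κ * L (Q * Q)) := by
  have hdiv : ∀ p : ℝ[X], ∃ p1, p = C (p.eval z) + (X - C z) * p1 := fun p =>
    ⟨p /ₘ (X - C z), by
      rw [← modByMonic_X_sub_C_eq_C_eval, modByMonic_add_div]⟩
  have key : ∀ p f f1 : ℝ[X], f = C (f.eval z) + (X - C z) * f1 →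
      Λ (p * f) = f.eval z * Λ p + κ * L (p * f1) := by
    intro p f f1 hf
    rw [← hΛ, ← smul_eq_mul (f.eval z), ← map_smul, ← map_add, smul_eq_C_mul]
    conv_lhs => rw [hf]
    congr 1
    ring
  have hdeg : ∀ (p p1 : ℝ[X]) (k : ℕ), p.natDegree = k + 1 → p = C (p.eval z) + (X - C z) * p1 →
      p1.natDegree = k ∧ p1.coeff k = p.coeff (k + 1) := by
    intro p p1 k hp h
    have hp1 : p1 ≠ 0 := by
      rintro rfl
      rw [h] at hp
      simp at hp
    have h2 : p.natDegree = p1.natDegree + 1 := by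
      rw [h, natDegree_C_add, (monic_X_sub_C z).natDegree_mul' hp1, natDegree_X_sub_C, add_comm]
    have h3 : p1.natDegree = k := by omega
    refine ⟨h3, ?_⟩
    conv_rhs => rw [h]
    rw [coeff_add, coeff_C_succ, sub_mul, coeff_sub, coeff_X_mul, coeff_C_mul,
      coeff_eq_zero_of_natDegree_lt (show p1.natDegree < k + 1 by omega)]
    ring
  -- Division by X - z and orthogonality give Λ(PP) = P(z)Λ(P), Λ(PQ) = Q(z)Λ(P), Λ(QQ) = Q(z)Λ(Q)
  -- and Λ(QP) = P(z)Λ(Q) + κ L(QQ). Both sides become P(z)Q(z)Λ(P)Λ(Q).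
  obtain ⟨P1, hP1⟩ := hdiv P
  obtain ⟨Q1, hQ1⟩ := hdiv Q
  obtain ⟨dP1, cP1⟩ := hdeg P P1 n hP.natDegree hP1
  rw [hP.coeff_self] at cP1
  have dQ1 : Q1.degree < n := by
    rcases n with _ | n
    · have : Q = 1 := by
        rw [eq_C_of_natDegree_eq_zero hQ.natDegree, hQ.coeff_self, C_1]
      rw [this, eval_one, C_1, left_eq_add, mul_eq_zero] at hQ1
      rcases hQ1 with h | h
      · exact absurd h (X_sub_C_ne_zero z)
      · simp [h]
    · have := (hdeg Q Q1 n hQ.natDegree hQ1).1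
      refine lt_of_le_of_lt degree_le_natDegree ?_
      rw [this]; exact_mod_cast Nat.lt_succ_self n
  have dP1' : P1.degree < (n + 1 : ℕ) := by
    refine lt_of_le_of_lt degree_le_natDegree ?_
    rw [dP1]; exact_mod_cast Nat.lt_succ_self n
  have e1 := key P P P1 hP1
  rw [hP.ortho _ dP1'] at e1
  have e2 := key P Q Q1 hQ1
  rw [hP.ortho _ (dQ1.trans (by exact_mod_cast Nat.lt_succ_self n))] at e2
  have e3 := key Q Q Q1 hQ1
  rw [hQ.ortho _ dQ1] at e3
  have e4 := key Q P P1 hP1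
  rw [hQ.apply_mul dP1', cP1, mul_comm Q P] at e4
  rw [e1, e3]
  have e5 : Λ (P * Q) - κ * L (Q * Q) = P.eval z * Λ Q := by rw [e4]; ring
  rw [e5, e2]
  ring

end PollaczekJacobi

/-! ### Residues of the Pearson equation and the algebraic σ-form -/

namespace PollaczekJacobi

open Polynomial

theorem degree_X_mul_derivative_lt {q : ℝ[X]} {n : ℕ} (hq : q.degree < n) :
    (X * derivative q : ℝ[X]).degree < (n : WithBot ℕ) := by
  rw [degree_lt_iff_coeff_zero] at hq ⊢
  intro k hk
  rcases k with _ | k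
  · simp
  · rw [coeff_X_mul, coeff_derivative, hq _ hk, zero_mul]

theorem coeff_X_mul_derivative (q : ℝ[X]) (n : ℕ) :
    (X * derivative q).coeff n = n * q.coeff n := by
  rcases n with _ | n
  · simp
  · rw [coeff_X_mul, coeff_derivative]; push_cast; ring

/-- The residue functional at `1`, which plays the role of `q ↦ β ∫ q v / (y - 1)` for the weight
`v = y ^ (-c) (y - 1) ^ β exp (-t y)`. -/
noncomputable def residueOne (L : ℝ[X] →ₗ[ℝ] ℝ) (t β c : ℝ) : ℝ[X] →ₗ[ℝ] ℝ :=
  -(L ∘ₗ (derivative ∘ₗ LinearMap.mulLeft ℝ X - t • LinearMap.mulLeft ℝ X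
    + (β - c) • LinearMap.id))

/-- The residue functional at `0`, which plays the role of `q ↦ -c ∫ q v / y`. -/
noncomputable def residueZero (L : ℝ[X] →ₗ[ℝ] ℝ) (t β c : ℝ) : ℝ[X] →ₗ[ℝ] ℝ :=
  -residueOne L t β c + t • L - L ∘ₗ derivative

/-- The Pearson equation of the weight `y ^ (-c) (y - 1) ^ β exp (-t y)`, integrated against
polynomials. -/
def Pearson (L : ℝ[X] →ₗ[ℝ] ℝ) (t β c : ℝ) : Prop :=
  ∀ q : ℝ[X], L (X * (X - 1) * derivative q) + (c - 1) * L q + (2 + β - c + t) * L (X * q)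
    - t * L (X * (X * q)) = 0

section residues

variable {L : ℝ[X] →ₗ[ℝ] ℝ} {t β c : ℝ}

theorem residueOne_apply (q : ℝ[X]) :
    residueOne L t β c q = -(L q + L (X * derivative q) - t * L (X * q) + (β - c) * L q) := by
  simp [residueOne, derivative_mul]

theorem residueZero_apply (q : ℝ[X]) :
    residueZero L t β c q = -residueOne L t β c q + t * L q - L (derivative q) := by
  simp [residueZero]

/-- This property replaces the integral of qv/(y-1), which can diverge for β ≤ 0: the functional is
what integration by parts of (yq)' v would give, and the Pearson equation does the rest. -/
theorem residueOne_mul (hL : Pearson L t β c) (q : ℝ[X]) :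
    residueOne L t β c ((X - C 1) * q) = β * L q := by
  have h := hL q
  rw [residueOne_apply, derivative_mul]
  simp only [C_1, derivative_X, derivative_one, sub_zero, one_mul, mul_add,
    sub_mul, mul_sub, map_add, map_sub, mul_assoc] at h ⊢
  linear_combination -h

theorem residueZero_mul (hL : Pearson L t β c) (q : ℝ[X]) :
    residueZero L t β c ((X - C 0) * q) = -c * L q := by
  have h := hL q
  rw [residueZero_apply, residueOne_apply]
  simp only [C_0, sub_zero, derivative_mul, derivative_X, one_mul, mul_add,
    sub_mul, mul_sub, map_add, map_sub, mul_assoc] at h ⊢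
  linear_combination h

theorem IsMonicOrtho.apply_derivative {n : ℕ} {P : ℝ[X]} (hP : IsMonicOrtho L n P) :
    L (P * derivative P) = 0 :=
  hP.ortho _ ((degree_derivative_lt hP.monic.ne_zero).trans_eq hP.degree)

theorem IsMonicOrtho.apply_X_mul_derivative {n : ℕ} {P : ℝ[X]} (hP : IsMonicOrtho L n P) :
    L (P * (X * derivative P)) = n * L (P * P) := by
  rw [hP.apply_mul, coeff_X_mul_derivative, hP.coeff_self, mul_one]
  apply degree_X_mul_derivative_lt
  rw [hP.degree]; exact_mod_cast Nat.lt_succ_self n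

theorem residueOne_sq {n : ℕ} {P : ℝ[X]} (hP : IsMonicOrtho L n P) :
    residueOne L t β c (P * P) =
      t * L (X * (P * P)) + (c - β - 2 * n - 1) * L (P * P) := by
  have h := hP.apply_X_mul_derivative
  have e : X * derivative (P * P) = P * (X * derivative P) + P * (X * derivative P) := by
    rw [derivative_mul]; ring
  rw [residueOne_apply, e, map_add, h]
  ring

theorem residueZero_sq {n : ℕ} {P : ℝ[X]} (hP : IsMonicOrtho L n P) :
    residueZero L t β c (P * P) = t * L (P * P) - residueOne L t β c (P * P) := by
  have h := hP.apply_derivative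
  rw [residueZero_apply, derivative_mul, mul_comm (derivative P), map_add, h]
  ring

theorem residueOne_mul_pred {n : ℕ} {P Q : ℝ[X]} (hP : IsMonicOrtho L (n + 1) P)
    (hQ : IsMonicOrtho L n Q) :
    residueOne L t β c (P * Q) = P.coeff n * L (Q * Q) + t * L (P * P) := by
  have hQd : Q.degree < (n + 1 : ℕ) := by
    rw [hQ.degree]; exact_mod_cast Nat.lt_succ_self n
  have e1 := hP.ortho _ hQd
  have e2 : L (P * (X * derivative Q)) = 0 := hP.ortho _ (degree_X_mul_derivative_lt hQd)
  have e3 : L (P * (X * Q)) = L (P * P) := by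
    rw [hP.apply_mul (degree_X_mul_lt hQd), coeff_X_mul, hQ.coeff_self, one_mul]
  -- X P' - (n+1) P has degree at most n, and its coefficient there is (n - (n+1)) times that of P.
  have e4 : L (X * derivative P * Q) = -P.coeff n * L (Q * Q) := by
    have hd : (X * derivative P : ℝ[X]).degree < ((n + 1 + 1 : ℕ) : WithBot ℕ) := by
      apply degree_X_mul_derivative_lt
      rw [hP.degree]; exact_mod_cast Nat.lt_succ_self _
    have h := hQ.apply_mul (hP.sub_degree_lt hd)
    rw [coeff_X_mul_derivative, hP.coeff_self, mul_sub, map_sub, coeff_sub, coeff_C_mul,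
      coeff_X_mul_derivative, mul_left_comm Q (C _), ← smul_eq_C_mul, map_smul, mul_comm Q P, e1,
      mul_comm Q, smul_zero, sub_zero] at h
    rw [h]; push_cast; ring
  have e5 : X * derivative (P * Q) = X * derivative P * Q + P * (X * derivative Q) := by
    rw [derivative_mul]; ring
  rw [residueOne_apply, e5, map_add, e2, e4, mul_left_comm, e3, e1]
  ring

theorem residueZero_mul_pred {n : ℕ} {P Q : ℝ[X]} (hP : IsMonicOrtho L (n + 1) P)
    (hQ : IsMonicOrtho L n Q) :
    residueZero L t β c (P * Q) = -residueOne L t β c (P * Q) - (n + 1) * L (Q * Q) := by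
  have hQd : Q.degree < (n + 1 : ℕ) := by
    rw [hQ.degree]; exact_mod_cast Nat.lt_succ_self n
  have e1 := hP.ortho _ hQd
  have e2 : L (P * derivative Q) = 0 :=
    hP.ortho _ ((degree_derivative_le).trans_lt hQd)
  have e3 : L (Q * derivative P) = (n + 1) * L (Q * Q) := by
    rw [hQ.apply_mul, coeff_derivative, hP.coeff_self, one_mul]
    exact (degree_derivative_lt hP.monic.ne_zero).trans_eq hP.degree
  rw [residueZero_apply, derivative_mul, mul_comm (derivative P), map_add, e1, e2, e3]
  ring

/-- The algebraic form of the `σ`-form of Painlevé V: here `r` is `H'`, `b` is `p'`, and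
`2 t b + t² b (a' - a)` is `t H''`. -/
theorem sigma_form_algebraic (hL : Pearson L t β c) (n : ℕ) {P Q : ℝ[X]}
    (hP : IsMonicOrtho L (n + 1) P) (hQ : IsMonicOrtho L n Q)
    (hP0 : L (P * P) ≠ 0) (hQ0 : L (Q * Q) ≠ 0) {a a' b p r : ℝ}
    (ha : a = L (X * (P * P)) / L (P * P)) (ha' : a' = L (X * (Q * Q)) / L (Q * Q))
    (hb : b = L (P * P) / L (Q * Q)) (hp : p = P.coeff n) (hr : r = p + t * b) :
    (2 * t * b + t ^ 2 * b * (a' - a)) ^ 2 =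
      (-t ^ 2 * b + (n + 1) * (n + 1 - c) + 2 * r ^ 2 + (2 * (n + 1) - c - β) * r) ^ 2
        - 4 * r * (r + (n + 1 - c)) * (r + (n + 1)) * (r - β) := by
  have hA := residue_identity (residueOne_mul hL) hP hQ
  have hB := residue_identity (residueZero_mul hL) hP hQ
  rw [residueZero_mul_pred hP hQ, residueZero_sq hP, residueZero_sq hQ,
    residueOne_mul_pred hP hQ, residueOne_sq hP, residueOne_sq hQ] at hB
  rw [residueOne_mul_pred hP hQ, residueOne_sq hP, residueOne_sq hQ] at hA
  have ea : L (X * (P * P)) = a * L (P * P) := by rw [ha]; field_simp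
  have ea' : L (X * (Q * Q)) = a' * L (Q * Q) := by rw [ha']; field_simp
  have eb : L (P * P) = b * L (Q * Q) := by rw [hb]; field_simp
  rw [ea, ea', eb, ← hp] at hA hB
  set k := L (Q * Q) with hk
  have hk2 : k ^ 2 ≠ 0 := pow_ne_zero 2 hQ0
  push_cast at hA hB
  -- The residues at 1 of P² and Q², divided by the norms; those at 0 are then t - ρ and t - ρ', and
  -- r is the residue at 1 of PQ divided by L(QQ).
  obtain ⟨ρ, hρ⟩ : ∃ ρ, ρ = t * a + c - β - 2 * (n + 1) - 1 := ⟨_, rfl⟩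
  obtain ⟨ρ', hρ'⟩ : ∃ ρ', ρ' = t * a' + c - β - 2 * n - 1 := ⟨_, rfl⟩
  have A : b * ρ * ρ' = r * (r - β) := by
    apply mul_left_cancel₀ hk2
    rw [hρ, hρ', hr]
    linear_combination hA
  have B : b * (t - ρ) * (t - ρ') = (r + (n + 1)) * (r + (n + 1) - c) := by
    apply mul_left_cancel₀ hk2
    rw [hρ, hρ', hr]
    linear_combination hB
  have e1 : 2 * t * b + t ^ 2 * b * (a' - a) = b * (t - ρ) * ρ' - b * ρ * (t - ρ') := by
    rw [hρ, hρ']; ring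
  have e2 : -(-t ^ 2 * b + (n + 1) * (n + 1 - c) + 2 * r ^ 2 + (2 * (n + 1) - c - β) * r) =
      b * (t - ρ) * ρ' + b * ρ * (t - ρ') := by
    linear_combination A + B
  have e3 : r * (r + (n + 1 - c)) * (r + (n + 1)) * (r - β) =
      (b * (t - ρ) * ρ') * (b * ρ * (t - ρ')) := by
    linear_combination (-(b * (t - ρ) * (t - ρ'))) * A - (r * (r - β)) * B
  rw [e1, ← neg_sq (-t ^ 2 * b + _ + _ + _), e2]
  linear_combination 4 * e3

end residues

end PollaczekJacobi

/-! ### Toda flow of the moments -/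

namespace PollaczekJacobi

open Polynomial

/-- Coefficientwise derivative of a family of polynomials. -/
def HasPolyDerivAt (f : ℝ → ℝ[X]) (f' : ℝ[X]) (t : ℝ) : Prop :=
  ∀ k, HasDerivAt (fun s => (f s).coeff k) (f'.coeff k) t

theorem HasPolyDerivAt.const (p : ℝ[X]) (t : ℝ) : HasPolyDerivAt (fun _ => p) 0 t := fun k => by
  simpa using hasDerivAt_const t (p.coeff k)

theorem HasPolyDerivAt.C {f : ℝ → ℝ} {f' t : ℝ} (hf : HasDerivAt f f' t) :
    HasPolyDerivAt (fun s => C (f s)) (C f') t := fun k => by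
  rcases k with _ | k
  · simpa using hf
  · simpa [coeff_C_succ] using hasDerivAt_const t (0 : ℝ)

theorem HasPolyDerivAt.sub {f g : ℝ → ℝ[X]} {f' g' : ℝ[X]} {t : ℝ} (hf : HasPolyDerivAt f f' t)
    (hg : HasPolyDerivAt g g' t) : HasPolyDerivAt (fun s => f s - g s) (f' - g') t := fun k => by
  simpa only [coeff_sub] using (hf k).fun_sub (hg k)

theorem HasPolyDerivAt.mul {f g : ℝ → ℝ[X]} {f' g' : ℝ[X]} {t : ℝ} (hf : HasPolyDerivAt f f' t)
    (hg : HasPolyDerivAt g g' t) :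
    HasPolyDerivAt (fun s => f s * g s) (f' * g t + f t * g') t := fun k => by
  simp only [coeff_add, coeff_mul, ← Finset.sum_add_distrib]
  exact HasDerivAt.fun_sum fun i _ => (hf i.1).mul (hg i.2)

theorem HasPolyDerivAt.degree_lt {f : ℝ → ℝ[X]} {f' : ℝ[X]} {t : ℝ} (hf : HasPolyDerivAt f f' t)
    {N : ℕ} (hN : ∀ k, N ≤ k → ∃ a, ∀ s, (f s).coeff k = a) : f'.degree < N := by
  rw [degree_lt_iff_coeff_zero]
  intro k hk
  obtain ⟨a, ha⟩ := hN k hk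
  have h := hf k
  simp only [ha] at h
  exact h.unique (hasDerivAt_const t a)

/-- The moments evolve by `m_k' = -m_{k+1}`, as those of a weight `v(y) exp (-t y)`. -/
def IsTodaFlow (m : ℝ → ℕ → ℝ) : Prop :=
  ∀ t, 0 < t → ∀ k, HasDerivAt (fun s => m s k) (-m t (k + 1)) t

variable {m : ℝ → ℕ → ℝ}

/-- The degree bound uniform in s makes the value a fixed finite sum, and m_k' = -m_{k+1} acts as
multiplication by -X. -/
theorem IsTodaFlow.hasDerivAt_apply (hm : IsTodaFlow m) {t : ℝ} (ht : 0 < t) {f : ℝ → ℝ[X]}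
    {f' : ℝ[X]} (hf : HasPolyDerivAt f f' t) {N : ℕ} (hN : ∀ s, (f s).natDegree < N) :
    HasDerivAt (fun s => momentFunctional (m s) (f s))
      (momentFunctional (m t) f' - momentFunctional (m t) (X * f t)) t := by
  have hN0 : 0 < N := (Nat.zero_le _).trans_lt (hN t)
  have hf' : f'.natDegree < N := by
    have := hf.degree_lt (N := N) fun k hk =>
      ⟨0, fun s => coeff_eq_zero_of_natDegree_lt ((hN s).trans_le hk)⟩
    by_cases h0 : f' = 0
    · simpa [h0]
    · exact (natDegree_lt_iff_degree_lt h0).2 this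
  have hX : (X * f t).natDegree < N + 1 := by
    have := natDegree_mul_le (p := X) (q := f t)
    have := natDegree_X_le (R := ℝ)
    have := hN t
    omega
  simp only [fun s => momentFunctional_eq_sum_range (m s) (hN s)]
  rw [momentFunctional_eq_sum_range _ hf', momentFunctional_eq_sum_range _ hX,
    Finset.sum_range_succ']
  simp only [coeff_X_mul, coeff_X_mul_zero, zero_mul, add_zero, ← Finset.sum_sub_distrib]
  refine HasDerivAt.fun_sum fun k _ => ?_
  exact ((hf k).fun_mul (hm t ht k)).congr_deriv (by ring)

/-- The recurrence pays off here: its coefficients are quotients of functionals of earlier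
polynomials, so differentiability propagates by induction. -/
theorem exists_hasPolyDerivAt_orthoPoly (hm : IsTodaFlow m)
    (hpos : ∀ t, 0 < t → IsPosDef (momentFunctional (m t))) {t : ℝ} (ht : 0 < t) (n : ℕ) :
    ∃ f', HasPolyDerivAt (fun s => orthoPoly (momentFunctional (m s)) n) f' t ∧ f'.degree < n := by
  suffices h : ∃ f', HasPolyDerivAt (fun s => orthoPoly (momentFunctional (m s)) n) f' t by
    obtain ⟨f', hf⟩ := h
    refine ⟨f', hf, hf.degree_lt fun k hk => ?_⟩
    rcases hk.eq_or_lt with rfl | hk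
    · refine ⟨1, fun s => ?_⟩
      obtain ⟨h1, h2⟩ := orthoPoly_monic_natDegree (momentFunctional (m s)) n
      simpa [h2] using h1.coeff_natDegree
    · refine ⟨0, fun s => coeff_eq_zero_of_natDegree_lt ?_⟩
      rwa [(orthoPoly_monic_natDegree (momentFunctional (m s)) n).2]
  have hne : ∀ k, opNorm (momentFunctional (m t)) k ≠ 0 := fun k =>
    (hpos t ht _ (orthoPoly_monic_natDegree _ k).1.ne_zero).ne'
  have hsq : ∀ n, (∃ f', HasPolyDerivAt (fun s => orthoPoly (momentFunctional (m s)) n) f' t) →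
      (∃ x, HasDerivAt (fun s => opNorm (momentFunctional (m s)) n) x t) ∧
      ∃ x, HasDerivAt (fun s => opDiag (momentFunctional (m s)) n) x t := by
    rintro n ⟨f', hf⟩
    have hdeg : ∀ s, (orthoPoly (momentFunctional (m s)) n *
        orthoPoly (momentFunctional (m s)) n).natDegree < 2 * n + 1 := fun s => by
      have h := natDegree_mul_le (p := orthoPoly (momentFunctional (m s)) n)
        (q := orthoPoly (momentFunctional (m s)) n)
      have := (orthoPoly_monic_natDegree (momentFunctional (m s)) n).2
      omega
    have hdeg' : ∀ s, (X * (orthoPoly (momentFunctional (m s)) n *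
        orthoPoly (momentFunctional (m s)) n)).natDegree < 2 * n + 2 := fun s => by
      have h := natDegree_mul_le (p := X) (q := orthoPoly (momentFunctional (m s)) n *
        orthoPoly (momentFunctional (m s)) n)
      have := natDegree_X_le (R := ℝ)
      have := hdeg s
      omega
    have h1 := hm.hasDerivAt_apply ht (hf.mul hf) hdeg
    have h2 := hm.hasDerivAt_apply ht ((HasPolyDerivAt.const X t).mul (hf.mul hf)) hdeg'
    exact ⟨⟨_, h1⟩, ⟨_, h2.div h1 (hne n)⟩⟩
  induction n using Nat.strong_induction_on with
  | _ n ih =>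
    match n, ih with
    | 0, _ => exact ⟨_, by simpa only [orthoPoly_zero] using HasPolyDerivAt.const 1 t⟩
    | 1, ih =>
      obtain ⟨_, x, hx⟩ := hsq 0 (ih 0 (by omega))
      simp only [orthoPoly_one]
      exact ⟨_, (HasPolyDerivAt.const X t).sub (HasPolyDerivAt.C hx)⟩
    | n + 2, ih =>
      obtain ⟨f1, h1⟩ := ih (n + 1) (by omega)
      obtain ⟨f0, h0⟩ := ih n (by omega)
      obtain ⟨⟨y, hy⟩, x, hx⟩ := hsq (n + 1) ⟨f1, h1⟩
      obtain ⟨⟨z, hz⟩, -⟩ := hsq n ⟨f0, h0⟩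
      simp only [orthoPoly_add_two]
      exact ⟨_, (((HasPolyDerivAt.const X t).sub (HasPolyDerivAt.C hx)).mul h1).sub
        ((HasPolyDerivAt.C (hy.div hz (hne n))).mul h0)⟩

theorem opNorm_pos (hpos : ∀ t, 0 < t → IsPosDef (momentFunctional (m t))) {t : ℝ} (ht : 0 < t)
    (n : ℕ) : 0 < opNorm (momentFunctional (m t)) n :=
  hpos t ht _ (orthoPoly_monic_natDegree _ n).1.ne_zero

/-- The derivative of P_n has degree < n and is orthogonal to P_n, so only the motion of the
functional contributes. -/
theorem hasDerivAt_opNorm (hm : IsTodaFlow m)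
    (hpos : ∀ t, 0 < t → IsPosDef (momentFunctional (m t))) {t : ℝ} (ht : 0 < t) (n : ℕ) :
    HasDerivAt (fun s => opNorm (momentFunctional (m s)) n)
      (-(opDiag (momentFunctional (m t)) n * opNorm (momentFunctional (m t)) n)) t := by
  obtain ⟨f', hf, hd⟩ := exists_hasPolyDerivAt_orthoPoly hm hpos ht n
  have hP := isMonicOrtho_orthoPoly (hpos t ht) n
  have h := hm.hasDerivAt_apply ht (hf.mul hf) (N := 2 * n + 1) fun s => by
    have h := natDegree_mul_le (p := orthoPoly (momentFunctional (m s)) n)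
      (q := orthoPoly (momentFunctional (m s)) n)
    have := (orthoPoly_monic_natDegree (momentFunctional (m s)) n).2
    omega
  refine h.congr_deriv ?_
  rw [opDiag, div_mul_cancel₀ _ (opNorm_pos hpos ht n).ne', mul_comm f', map_add, hP.ortho _ hd]
  ring

theorem differentiableAt_opDiag (hm : IsTodaFlow m)
    (hpos : ∀ t, 0 < t → IsPosDef (momentFunctional (m t))) {t : ℝ} (ht : 0 < t) (n : ℕ) :
    DifferentiableAt ℝ (fun s => opDiag (momentFunctional (m s)) n) t := by
  obtain ⟨f', hf, hd⟩ := exists_hasPolyDerivAt_orthoPoly hm hpos ht n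
  have h := hm.hasDerivAt_apply ht ((HasPolyDerivAt.const X t).mul (hf.mul hf)) (N := 2 * n + 2)
    fun s => by
      have h := natDegree_mul_le (p := orthoPoly (momentFunctional (m s)) n)
        (q := orthoPoly (momentFunctional (m s)) n)
      have h := natDegree_mul_le (p := X) (q := orthoPoly (momentFunctional (m s)) n *
        orthoPoly (momentFunctional (m s)) n)
      have := natDegree_X_le (R := ℝ)
      have := (orthoPoly_monic_natDegree (momentFunctional (m s)) n).2
      omega
  exact (h.div (hasDerivAt_opNorm hm hpos ht n) (opNorm_pos hpos ht n).ne').differentiableAt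

theorem hasDerivAt_coeff_orthoPoly (hm : IsTodaFlow m)
    (hpos : ∀ t, 0 < t → IsPosDef (momentFunctional (m t))) {t : ℝ} (ht : 0 < t) (n : ℕ) :
    HasDerivAt (fun s => (orthoPoly (momentFunctional (m s)) (n + 1)).coeff n)
      (opNorm (momentFunctional (m t)) (n + 1) / opNorm (momentFunctional (m t)) n) t := by
  obtain ⟨f', hf, hd⟩ := exists_hasPolyDerivAt_orthoPoly hm hpos ht (n + 1)
  have hP := isMonicOrtho_orthoPoly (hpos t ht) (n + 1)
  have hQ := isMonicOrtho_orthoPoly (hpos t ht) n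
  set Q := orthoPoly (momentFunctional (m t)) n with hQdef
  have hQd : Q.degree < (n + 1 : ℕ) := by
    rw [hQ.degree]; exact_mod_cast Nat.lt_succ_self n
  have h := hm.hasDerivAt_apply ht (hf.mul (HasPolyDerivAt.const Q t)) (N := 2 * n + 2)
    fun s => by
      have h := natDegree_mul_le (p := orthoPoly (momentFunctional (m s)) (n + 1)) (q := Q)
      have := (orthoPoly_monic_natDegree (momentFunctional (m s)) (n + 1)).2
      have := hQ.natDegree
      omega
  -- With Q frozen at time t, the pairing with P_{n+1} vanishes for all s near t; its zero
  -- derivative is p' h_n - h_{n+1}.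
  have h0 : HasDerivAt (fun s => momentFunctional (m s)
      (orthoPoly (momentFunctional (m s)) (n + 1) * Q)) 0 t := by
    refine (hasDerivAt_const t (0 : ℝ)).congr_of_eventuallyEq ?_
    filter_upwards [lt_mem_nhds ht] with s hs
    exact (isMonicOrtho_orthoPoly (hpos s hs) (n + 1)).ortho _ hQd
  have e := h.unique h0
  rw [mul_zero, add_zero, mul_comm f', hQ.apply_mul hd, mul_left_comm,
    hP.apply_mul (degree_X_mul_lt hQd), coeff_X_mul, hQ.coeff_self, one_mul, sub_eq_zero] at e
  convert hf n using 1
  rw [opNorm, ← e]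
  exact mul_div_cancel_right₀ _ (opNorm_pos hpos ht n).ne'

theorem coeff_orthoPoly_succ (L : ℝ[X] →ₗ[ℝ] ℝ) (n : ℕ) :
    (orthoPoly L (n + 1)).coeff n = -∑ j ∈ Finset.range (n + 1), opDiag L j := by
  induction n with
  | zero => simp [orthoPoly_one]
  | succ n ih =>
    have h1 : (orthoPoly L (n + 1)).coeff (n + 1) = 1 := by
      have := (orthoPoly_monic_natDegree L (n + 1)).1.coeff_natDegree
      rwa [(orthoPoly_monic_natDegree L (n + 1)).2] at this
    have h0 : (orthoPoly L n).coeff (n + 1) = 0 :=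
      coeff_eq_zero_of_natDegree_lt (by rw [(orthoPoly_monic_natDegree L n).2]; omega)
    rw [orthoPoly_add_two, sub_mul, coeff_sub, coeff_sub, coeff_X_mul, coeff_C_mul, coeff_C_mul,
      h1, h0, ih, Finset.sum_range_succ _ (n + 1)]
    ring

/-- The Hankel determinant of the moments `m t`. -/
noncomputable def hankelDet (m : ℝ → ℕ → ℝ) (n : ℕ) (t : ℝ) : ℝ :=
  (Matrix.of fun i j : Fin n => m t (i + j)).det

theorem hankelDet_pos (hpos : ∀ t, 0 < t → IsPosDef (momentFunctional (m t))) {t : ℝ}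
    (ht : 0 < t) (n : ℕ) : 0 < hankelDet m n t := by
  rw [hankelDet, det_hankel_eq_prod _ (hpos t ht)]
  exact Finset.prod_pos fun j _ => opNorm_pos hpos ht j

theorem differentiableAt_hankelDet (hm : IsTodaFlow m)
    (hpos : ∀ t, 0 < t → IsPosDef (momentFunctional (m t))) {t : ℝ} (ht : 0 < t) (n : ℕ) :
    DifferentiableAt ℝ (hankelDet m n) t := by
  have h : DifferentiableAt ℝ
      (fun s => ∏ j ∈ Finset.range n, opNorm (momentFunctional (m s)) j) t :=
    DifferentiableAt.fun_finsetProd fun j _ => (hasDerivAt_opNorm hm hpos ht j).differentiableAt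
  refine h.congr_of_eventuallyEq ?_
  filter_upwards [lt_mem_nhds ht] with s hs
  rw [hankelDet, det_hankel_eq_prod _ (hpos s hs)]

theorem deriv_log_hankelDet (hm : IsTodaFlow m)
    (hpos : ∀ t, 0 < t → IsPosDef (momentFunctional (m t))) {t : ℝ} (ht : 0 < t) (n : ℕ) :
    deriv (fun s => Real.log (hankelDet m (n + 1) s)) t =
      (orthoPoly (momentFunctional (m t)) (n + 1)).coeff n := by
  have h : HasDerivAt
      (fun s => ∑ j ∈ Finset.range (n + 1), Real.log (opNorm (momentFunctional (m s)) j))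
      (∑ j ∈ Finset.range (n + 1), -opDiag (momentFunctional (m t)) j) t := by
    refine HasDerivAt.fun_sum fun j _ => ?_
    have hj := opNorm_pos hpos ht j
    refine ((hasDerivAt_opNorm hm hpos ht j).log hj.ne').congr_deriv ?_
    field_simp
  rw [coeff_orthoPoly_succ, ← Finset.sum_neg_distrib]
  refine (h.congr_of_eventuallyEq ?_).deriv
  filter_upwards [lt_mem_nhds ht] with s hs
  rw [hankelDet, det_hankel_eq_prod _ (hpos s hs),
    Real.log_prod fun j _ => (opNorm_pos hpos hs j).ne']

theorem contDiffOn_succ_of_hasDerivAt {f f' : ℝ → ℝ} {k : ℕ} {s : Set ℝ} (hs : IsOpen s)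
    (hf : ∀ t ∈ s, HasDerivAt f (f' t) t) (hf' : ContDiffOn ℝ k f' s) :
    ContDiffOn ℝ (k + 1 : ℕ) f s := by
  push_cast
  rw [contDiffOn_succ_iff_deriv_of_isOpen hs]
  refine ⟨fun t ht => (hf t ht).differentiableAt.differentiableWithinAt, by simp,
    hf'.congr fun t ht => (hf t ht).deriv⟩

/-- The `σ`-form of Painlevé V for the logarithmic derivative of the Hankel determinant of a
Toda flow of positive definite moments which satisfies the Pearson equation. -/
theorem isSigmaPainleveV_hankelDet (hm : IsTodaFlow m)
    (hpos : ∀ t, 0 < t → IsPosDef (momentFunctional (m t))) {β c : ℝ}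
    (hL : ∀ t, 0 < t → Pearson (momentFunctional (m t)) t β c) (n : ℕ) :
    IsSigmaPainleveV 0 (n + 1 - c) (n + 1) (-β) (fun t =>
      t * deriv (fun s => Real.log (hankelDet m (n + 1) s)) t - (n + 1) * (c - (n + 1))) := by
  set H : ℝ → ℝ := fun t =>
      t * deriv (fun s => Real.log (hankelDet m (n + 1) s)) t - (n + 1) * (c - (n + 1)) with hH
  obtain ⟨p, hp⟩ : ∃ p : ℝ → ℝ,
      p = fun t => (orthoPoly (momentFunctional (m t)) (n + 1)).coeff n := ⟨_, rfl⟩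
  obtain ⟨b, hb⟩ : ∃ b : ℝ → ℝ, b = fun t =>
      opNorm (momentFunctional (m t)) (n + 1) / opNorm (momentFunctional (m t)) n := ⟨_, rfl⟩
  obtain ⟨a, ha⟩ : ∃ a : ℝ → ℝ, a = fun t =>
      opDiag (momentFunctional (m t)) n - opDiag (momentFunctional (m t)) (n + 1) := ⟨_, rfl⟩
  have hp' : ∀ t ∈ Set.Ioi (0 : ℝ), HasDerivAt p (b t) t := fun t ht => by
    rw [hp, hb]; exact hasDerivAt_coeff_orthoPoly hm hpos ht n
  have hb' : ∀ t ∈ Set.Ioi (0 : ℝ), HasDerivAt b (b t * a t) t := fun t ht => by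
    have h0 := (opNorm_pos hpos ht n).ne'
    rw [hb, ha]
    refine ((hasDerivAt_opNorm hm hpos ht (n + 1)).fun_div (hasDerivAt_opNorm hm hpos ht n)
      h0).congr_deriv ?_
    field_simp
    ring
  have hHp : ∀ t ∈ Set.Ioi (0 : ℝ), H t = t * p t - (n + 1) * (c - (n + 1)) := fun t ht => by
    rw [hH, hp]
    simp only [deriv_log_hankelDet hm hpos ht n]
  have hH' : ∀ t ∈ Set.Ioi (0 : ℝ), HasDerivAt H (p t + t * b t) t := fun t ht => by
    have h := ((hasDerivAt_id' t).mul (hp' t ht)).sub_const (((n : ℝ) + 1) * (c - (n + 1)))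
    rw [one_mul] at h
    refine h.congr_of_eventuallyEq ?_
    filter_upwards [lt_mem_nhds ht] with s hs using hHp s hs
  have hH'' : ∀ t ∈ Set.Ioi (0 : ℝ),
      HasDerivAt (deriv H) (2 * b t + t * (b t * a t)) t := fun t ht => by
    have h := (hp' t ht).add ((hasDerivAt_id' t).mul (hb' t ht))
    rw [show b t + (1 * b t + t * (b t * a t)) = 2 * b t + t * (b t * a t) by ring] at h
    refine h.congr_of_eventuallyEq ?_
    filter_upwards [lt_mem_nhds ht] with s hs using (hH' s hs).deriv
  -- Continuity of the diagonal coefficients suffices for C², since H'' is an explicit expression in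
  -- b and a.
  have hac : ContinuousOn a (Set.Ioi 0) := fun t ht => by
    rw [ha]
    exact ((differentiableAt_opDiag hm hpos ht n).sub
      (differentiableAt_opDiag hm hpos ht (n + 1))).continuousAt.continuousWithinAt
  have hbc : ContinuousOn b (Set.Ioi 0) := fun t ht =>
    (hb' t ht).continuousAt.continuousWithinAt
  refine ⟨?_, fun t ht => ?_⟩
  · have h1 : ContDiffOn ℝ (0 : ℕ) (fun t => 2 * b t + t * (b t * a t)) (Set.Ioi 0) := by
      rw [Nat.cast_zero, contDiffOn_zero]
      exact (continuousOn_const.mul hbc).add (continuousOn_id.mul (hbc.mul hac))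
    have h2 := contDiffOn_succ_of_hasDerivAt isOpen_Ioi hH'' h1
    have h3 := contDiffOn_succ_of_hasDerivAt isOpen_Ioi
      (fun t ht => (hH' t ht).differentiableAt.hasDerivAt) h2
    exact_mod_cast h3
  · have key := sigma_form_algebraic (hL t ht) n (isMonicOrtho_orthoPoly (hpos t ht) (n + 1))
      (isMonicOrtho_orthoPoly (hpos t ht) n) (opNorm_pos hpos ht (n + 1)).ne'
      (opNorm_pos hpos ht n).ne' rfl rfl rfl rfl rfl
    have e1 : t * deriv (deriv H) t = 2 * t * b t + t ^ 2 * b t * a t := by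
      rw [(hH'' t ht).deriv]; ring
    have e2 := (hH' t ht).deriv
    rw [e1, e2, hHp t ht]
    rw [hp, hb, ha]
    simp only [opDiag, opNorm] at key ⊢
    rw [key]
    ring

end PollaczekJacobi

/-! ### Analysis of the Pollaczek–Jacobi weight and the variable y = 1/x -/

namespace PollaczekJacobi

open MeasureTheory Set Filter Topology Polynomial

/-- From exp(t/x) ≥ (t/x)^N / N! with N ≥ -γ. Every real γ is allowed, as the exponents γ - k of the
y-moments require. -/
theorem exists_rpow_mul_exp_le (γ : ℝ) {t : ℝ} (ht : 0 < t) :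
    ∃ K, ∀ x ∈ Ioc (0 : ℝ) 1, x ^ γ * Real.exp (-t / x) ≤ K := by
  obtain ⟨N, hN⟩ := exists_nat_ge (-γ)
  refine ⟨N.factorial / t ^ N, fun x hx => ?_⟩
  have h1 : x ^ γ ≤ (x ^ N)⁻¹ := by
    rw [← Real.rpow_natCast, ← Real.rpow_neg hx.1.le]
    exact Real.rpow_le_rpow_of_exponent_ge hx.1 hx.2 (by linarith)
  have h2 := Real.pow_div_factorial_le_exp (t / x) (div_pos ht hx.1).le N
  have h3 : Real.exp (-t / x) = (Real.exp (t / x))⁻¹ := by rw [neg_div, Real.exp_neg]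
  have hx0 := hx.1
  rw [h3, ← div_eq_mul_inv, div_le_div_iff₀ (Real.exp_pos _) (pow_pos ht N)]
  rw [div_le_iff₀ (by positivity), div_pow] at h2
  calc x ^ γ * t ^ N ≤ (x ^ N)⁻¹ * t ^ N := by gcongr
    _ = t ^ N / x ^ N := by rw [div_eq_mul_inv, mul_comm]
    _ ≤ _ := by rw [mul_comm]; exact h2

theorem integrableOn_one_sub_rpow {β : ℝ} (hβ : -1 < β) :
    IntegrableOn (fun x : ℝ => (1 - x) ^ β) (Ioc 0 1) := by
  have h := (intervalIntegral.intervalIntegrable_rpow' (a := 0) (b := 1) hβ).comp_sub_left 1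
  simp only [sub_zero, sub_self] at h
  exact (intervalIntegrable_iff_integrableOn_Ioc_of_le zero_le_one).1 h.symm

theorem integrableOn_pjWeight (γ : ℝ) {β t : ℝ} (hβ : -1 < β) (ht : 0 < t) :
    IntegrableOn (pjWeight γ β t) (Ioc 0 1) := by
  obtain ⟨K, hK⟩ := exists_rpow_mul_exp_le γ ht
  refine ((integrableOn_one_sub_rpow hβ).const_mul K).mono' ?_ ?_
  · unfold pjWeight
    exact (by fun_prop : Measurable _).aestronglyMeasurable
  · refine (ae_restrict_iff' measurableSet_Ioc).2 (ae_of_all _ fun x hx => ?_)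
    have h1 : 0 ≤ (1 - x) ^ β := Real.rpow_nonneg (by linarith [hx.2]) _
    have h2 : 0 ≤ x ^ γ := Real.rpow_nonneg hx.1.le _
    rw [pjWeight, Real.norm_of_nonneg (by positivity),
      show x ^ γ * (1 - x) ^ β * Real.exp (-t / x) = x ^ γ * Real.exp (-t / x) * (1 - x) ^ β by ring]
    exact mul_le_mul_of_nonneg_right (hK x hx) h1

/-- The total mass of the Pollaczek–Jacobi weight with exponent `γ`, which may be any real. -/
noncomputable def pjMass (β γ t : ℝ) : ℝ := ∫ x in (0 : ℝ)..1, pjWeight γ β t x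

theorem hasDerivAt_pjMass (γ : ℝ) {β t : ℝ} (hβ : -1 < β) (ht : 0 < t) :
    HasDerivAt (pjMass β γ) (-pjMass β (γ - 1) t) t := by
  unfold pjMass
  simp only [intervalIntegral.integral_of_le zero_le_one]
  rw [← integral_neg]
  -- On s > t/2 the s-derivative is dominated by the weight at t/2 with exponent γ - 1.
  refine (hasDerivAt_integral_of_dominated_loc_of_deriv_le (μ := volume.restrict (Ioc 0 1))
    (F := fun s x => pjWeight γ β s x) (F' := fun s x => -pjWeight (γ - 1) β s x)
    (bound := pjWeight (γ - 1) β (t / 2)) (Ioi_mem_nhds (half_lt_self ht)) ?_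
    (integrableOn_pjWeight γ hβ ht) ?_ ?_ (integrableOn_pjWeight _ hβ (half_pos ht)) ?_).2
  · exact Eventually.of_forall fun s => by
      unfold pjWeight
      exact (by fun_prop : Measurable _).aestronglyMeasurable
  · unfold pjWeight
    exact (by fun_prop : Measurable _).aestronglyMeasurable
  · refine (ae_restrict_iff' measurableSet_Ioc).2 (ae_of_all _ fun x hx s hs => ?_)
    have h1 : 0 ≤ (1 - x) ^ β := Real.rpow_nonneg (by linarith [hx.2]) _
    have h2 : 0 ≤ x ^ (γ - 1) := Real.rpow_nonneg hx.1.le _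
    have hx0 := hx.1
    rw [norm_neg, pjWeight, pjWeight, Real.norm_of_nonneg (by positivity)]
    have hs' : t / 2 < s := hs
    gcongr
  · refine (ae_restrict_iff' measurableSet_Ioc).2 (ae_of_all _ fun x hx s hs => ?_)
    have hx0 := hx.1
    have h : HasDerivAt (fun s : ℝ => Real.exp (-s / x)) (Real.exp (-s / x) * (-1 / x)) s :=
      ((hasDerivAt_neg s).div_const x).exp
    refine (h.const_mul (x ^ γ * (1 - x) ^ β)).congr_deriv ?_
    rw [pjWeight, Real.rpow_sub_one hx0.ne']
    field_simp

theorem tendsto_pjWeight_zero (γ β : ℝ) {t : ℝ} (ht : 0 < t) :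
    Tendsto (pjWeight γ β t) (𝓝[>] 0) (𝓝 0) := by
  have h1 : Tendsto (fun x : ℝ => x ^ γ * Real.exp (-t / x)) (𝓝[>] 0) (𝓝 0) := by
    have h := (tendsto_rpow_mul_exp_neg_mul_atTop_nhds_zero (-γ) t ht).comp
      tendsto_inv_nhdsGT_zero
    refine h.congr' ?_
    filter_upwards [self_mem_nhdsWithin] with x hx
    rw [Function.comp_apply, Real.inv_rpow (le_of_lt hx), Real.rpow_neg (le_of_lt hx), inv_inv,
      div_eq_mul_inv]
  have h2 : Tendsto (fun x : ℝ => (1 - x) ^ β) (𝓝[>] 0) (𝓝 1) := by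
    have : ContinuousAt (fun x : ℝ => (1 - x) ^ β) 0 :=
      ContinuousAt.rpow_const (by fun_prop) (Or.inl (by norm_num))
    simpa using this.tendsto.mono_left nhdsWithin_le_nhds
  have := h1.mul h2
  rw [zero_mul] at this
  refine this.congr fun x => ?_
  rw [pjWeight]; ring

theorem hasDerivAt_pjWeight (γ β t : ℝ) {x : ℝ} (hx : x ∈ Ioo (0 : ℝ) 1) :
    HasDerivAt (pjWeight γ (β + 1) t)
      ((γ - t) * pjWeight (γ - 1) β t x - (γ + β + 1) * pjWeight γ β t x
        + t * pjWeight (γ - 1 - 1) β t x) x := by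
  have hx0 := hx.1
  have hx1 : 0 < 1 - x := by linarith [hx.2]
  have h1 := Real.hasDerivAt_rpow_const (p := γ) (Or.inl hx0.ne')
  have h2 : HasDerivAt (fun x : ℝ => (1 - x) ^ (β + 1)) (-1 * (β + 1) * (1 - x) ^ (β + 1 - 1)) x :=
    ((hasDerivAt_id' x).const_sub 1).rpow_const (Or.inl hx1.ne')
  have h3 : HasDerivAt (fun x : ℝ => Real.exp (-t / x))
      (Real.exp (-t / x) * ((0 * x - -t * 1) / x ^ 2)) x :=
    ((hasDerivAt_const x (-t)).fun_div (hasDerivAt_id' x) hx0.ne').exp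
  refine ((h1.fun_mul h2).fun_mul h3).congr_deriv ?_
  simp only [pjWeight, add_sub_cancel_right, Real.rpow_add_one hx1.ne',
    Real.rpow_sub_one hx0.ne']
  field_simp
  ring

/-- Integrate the derivative of the weight with β + 1 in place of β: it vanishes at 1 because β + 1
> 0, and at 0 by the exponential. -/
theorem pjMass_recurrence (γ : ℝ) {β t : ℝ} (hβ : -1 < β) (ht : 0 < t) :
    (γ - t) * pjMass β (γ - 1) t - (γ + β + 1) * pjMass β γ t + t * pjMass β (γ - 1 - 1) t = 0 := by
  have hi : ∀ γ, IntervalIntegrable (pjWeight γ β t) volume 0 1 := fun γ =>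
    (intervalIntegrable_iff_integrableOn_Ioc_of_le zero_le_one).2 (integrableOn_pjWeight γ hβ ht)
  have h1 : Tendsto (pjWeight γ (β + 1) t) (𝓝[<] 1) (𝓝 0) := by
    have h : ContinuousAt (pjWeight γ (β + 1) t) 1 := by
      unfold pjWeight
      refine ((continuousAt_id.rpow_const (Or.inl one_ne_zero)).mul
        (ContinuousAt.rpow_const (by fun_prop) (Or.inr (by linarith)))).mul ?_
      exact (continuousAt_const.div continuousAt_id one_ne_zero).rexp
    have h0 : pjWeight γ (β + 1) t 1 = 0 := by
      simp [pjWeight, Real.zero_rpow (by linarith : β + 1 ≠ 0)]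
    rw [← h0]
    exact h.tendsto.mono_left nhdsWithin_le_nhds
  have h := intervalIntegral.integral_eq_sub_of_hasDerivAt_of_tendsto zero_lt_one
    (fun x hx => hasDerivAt_pjWeight γ β t hx)
    ((((hi (γ - 1)).const_mul _).sub ((hi γ).const_mul _)).add ((hi (γ - 1 - 1)).const_mul _))
    (tendsto_pjWeight_zero γ (β + 1) ht) h1
  rw [intervalIntegral.integral_add (((hi (γ - 1)).const_mul _).sub ((hi γ).const_mul _))
    ((hi (γ - 1 - 1)).const_mul _), intervalIntegral.integral_sub ((hi (γ - 1)).const_mul _)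
    ((hi γ).const_mul _)] at h
  simp only [intervalIntegral.integral_const_mul, sub_zero] at h
  exact h

/-- The moments of the Pollaczek–Jacobi weight in the variable `y = 1 / x`. -/
noncomputable def invMoment (β γ t : ℝ) (k : ℕ) : ℝ := pjMass β (γ - k) t

theorem isTodaFlow_invMoment {β : ℝ} (hβ : -1 < β) (γ : ℝ) : IsTodaFlow (invMoment β γ) := by
  intro t ht k
  have h := hasDerivAt_pjMass (γ - k) hβ ht
  unfold invMoment
  push_cast
  rwa [← sub_sub]

/-- In c = γ + β + 2, the β comes from (1-x)^β = y^(-β) (y-1)^β and the 2 from dx = -dy/y². On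
monomials this is `pjMass_recurrence` at γ - k. -/
theorem pearson_invMoment {β : ℝ} (hβ : -1 < β) (γ : ℝ) {t : ℝ} (ht : 0 < t) :
    Pearson (momentFunctional (invMoment β γ t)) t β (γ + β + 2) := by
  intro q
  induction q using Polynomial.induction_on' with
  | add p q hp hq =>
    simp only [mul_add, map_add] at hp hq ⊢
    linear_combination hp + hq
  | monomial k a =>
    have h1 : X * (X - 1) * derivative (monomial k a) =
        (a * k) • (X ^ (k + 1) : ℝ[X]) - (a * k) • (X ^ k : ℝ[X]) := by
      rw [derivative_monomial, ← C_mul_X_pow_eq_monomial, smul_eq_C_mul, smul_eq_C_mul]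
      rcases k with _ | k
      · simp
      · rw [Nat.add_sub_cancel]; ring
    have h2 : monomial k a = a • (X ^ k : ℝ[X]) := by
      rw [smul_eq_C_mul, C_mul_X_pow_eq_monomial]
    have h3 : X * monomial k a = a • (X ^ (k + 1) : ℝ[X]) := by
      rw [h2, mul_smul_comm, pow_succ']
    have h4 : X * (X * monomial k a) = a • (X ^ (k + 2) : ℝ[X]) := by
      rw [h3, mul_smul_comm, ← pow_succ']
    rw [h1, h3, mul_smul_comm, ← pow_succ', h2]
    simp only [map_sub, map_smul, momentFunctional_X_pow, smul_eq_mul, invMoment]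
    have h := pjMass_recurrence (γ - k) hβ ht
    have e1 : γ - ((k + 1 : ℕ) : ℝ) = γ - k - 1 := by push_cast; ring
    have e2 : γ - ((k + 1 + 1 : ℕ) : ℝ) = γ - k - 1 - 1 := by push_cast; ring
    rw [e1, e2]
    linear_combination -a * h

theorem pjWeight_pos {γ β t x : ℝ} (hx : x ∈ Ioo (0 : ℝ) 1) : 0 < pjWeight γ β t x := by
  have h1 : 0 < (1 - x) ^ β := Real.rpow_pos_of_pos (by linarith [hx.2]) _
  have h2 : 0 < x ^ γ := Real.rpow_pos_of_pos hx.1 _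
  unfold pjWeight
  positivity

theorem momentFunctional_invMoment {β : ℝ} (hβ : -1 < β) (γ : ℝ) {t : ℝ} (ht : 0 < t) (q : ℝ[X]) :
    IntegrableOn (fun x => q.eval x⁻¹ * pjWeight γ β t x) (Ioc 0 1) ∧
      momentFunctional (invMoment β γ t) q =
        ∫ x in Ioc (0 : ℝ) 1, q.eval x⁻¹ * pjWeight γ β t x := by
  induction q using Polynomial.induction_on' with
  | add p q hp hq =>
    simp only [eval_add, add_mul, map_add]
    exact ⟨hp.1.add hq.1, by rw [integral_add hp.1 hq.1, hp.2, hq.2]⟩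
  | monomial k a =>
    have h : EqOn (fun x => a * pjWeight (γ - k) β t x)
        (fun x => (monomial k a).eval x⁻¹ * pjWeight γ β t x) (Ioc 0 1) := fun x hx => by
      simp only [eval_monomial, pjWeight, Real.rpow_sub_natCast hx.1.ne', inv_pow]
      ring
    refine ⟨IntegrableOn.congr_fun ((integrableOn_pjWeight (γ - k) hβ ht).const_mul a) h
      measurableSet_Ioc, ?_⟩
    rw [← setIntegral_congr_fun measurableSet_Ioc h, integral_const_mul, ← C_mul_X_pow_eq_monomial,
      ← smul_eq_C_mul, map_smul, momentFunctional_X_pow, invMoment, pjMass,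
      intervalIntegral.integral_of_le zero_le_one, smul_eq_mul]

theorem isPosDef_invMoment {β : ℝ} (hβ : -1 < β) (γ : ℝ) {t : ℝ} (ht : 0 < t) :
    IsPosDef (momentFunctional (invMoment β γ t)) := by
  intro q hq
  obtain ⟨hi, he⟩ := momentFunctional_invMoment hβ γ ht (q * q)
  rw [he, integral_Ioc_eq_integral_Ioo]
  have hi' := hi.mono_set Ioo_subset_Ioc_self
  have hnn : ∀ x ∈ Ioo (0 : ℝ) 1, 0 ≤ (q * q).eval x⁻¹ * pjWeight γ β t x := fun x hx => by
    rw [eval_mul]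
    exact mul_nonneg (mul_self_nonneg _) (pjWeight_pos hx).le
  rw [setIntegral_pos_iff_support_of_nonneg_ae
    ((ae_restrict_iff' measurableSet_Ioo).2 (ae_of_all _ hnn)) hi']
  have hfin : (Inv.inv '' {x : ℝ | q.IsRoot x}).Finite := (finite_setOfPred_isRoot hq).image _
  have hsub : Ioo (0 : ℝ) 1 \ (Inv.inv '' {x : ℝ | q.IsRoot x}) ⊆
      Function.support (fun x => (q * q).eval x⁻¹ * pjWeight γ β t x) ∩ Ioo 0 1 := by
    rintro x ⟨hx, hr⟩
    refine ⟨?_, hx⟩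
    rw [Function.mem_support, eval_mul]
    refine mul_ne_zero (mul_self_ne_zero.2 fun h => hr ⟨x⁻¹, h, inv_inv x⟩) (pjWeight_pos hx).ne'
  refine lt_of_lt_of_le ?_ (measure_mono hsub)
  rw [measure_sdiff_null (hfin.measure_zero _)]
  simp

theorem pjMoment_eq_pjMass (α β : ℝ) (k : ℕ) (t : ℝ) :
    pjMoment α β k t = pjMass β (k + α) t := by
  unfold pjMoment pjMass
  refine intervalIntegral.integral_congr_ae (ae_of_all _ fun x hx => ?_)
  rw [uIoc_of_le zero_le_one] at hx
  simp only [pjWeight]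
  rw [Real.rpow_add hx.1, Real.rpow_natCast]
  ring

/-- The reversal i ↦ n-1-i sends i + j to 2n-2-(i+j), so the exponent in y depends on n; each n has
its own weight. -/
theorem pjHankel_eq_hankelDet (α β : ℝ) (n : ℕ) (t : ℝ) :
    pjHankel α β n t = hankelDet (invMoment β (2 * n - 2 + α)) n t := by
  rw [pjHankel, hankelDet, ← Matrix.det_submatrix_equiv_self Fin.revPerm]
  congr 1
  ext i j
  simp only [Matrix.submatrix_apply, Matrix.of_apply, pjMoment_eq_pjMass, invMoment,
    Fin.revPerm_apply, Fin.val_rev]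
  congr 1
  rw [Nat.cast_add, Nat.cast_sub (by omega), Nat.cast_sub (by omega)]
  push_cast
  ring

theorem pjHankel_pos (α : ℝ) {β : ℝ} (hβ : -1 < β) (n : ℕ) {t : ℝ} (ht : 0 < t) :
    0 < pjHankel α β n t := by
  rw [pjHankel_eq_hankelDet]
  exact hankelDet_pos (fun t ht => isPosDef_invMoment hβ _ ht) ht n

theorem differentiableAt_pjHankel (α : ℝ) {β : ℝ} (hβ : -1 < β) (n : ℕ) {t : ℝ} (ht : 0 < t) :
    DifferentiableAt ℝ (pjHankel α β n) t := by
  rw [funext (pjHankel_eq_hankelDet α β n)]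
  exact differentiableAt_hankelDet (isTodaFlow_invMoment hβ _)
    (fun t ht => isPosDef_invMoment hβ _ ht) ht n

theorem isSigmaPainleveV_Htilde (α : ℝ) {β : ℝ} (hβ : -1 < β) (n : ℕ) :
    IsSigmaPainleveV 0 (-(n + α + β)) n (-β) (fun t => Htilde n t α β) := by
  rcases n with _ | n
  -- The general argument needs the predecessor P_{n-1}, absent for n = 0.
  · have h : (fun t => Htilde 0 t α β) = fun _ => 0 := by
      funext t
      simp [Htilde, pjHankel]
    rw [h]
    refine ⟨contDiffOn_const, fun t _ => ?_⟩
    simp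
  · have h := isSigmaPainleveV_hankelDet (isTodaFlow_invMoment hβ (2 * (n + 1 : ℕ) - 2 + α))
      (fun t ht => isPosDef_invMoment hβ _ ht) (fun t ht => pearson_invMoment hβ _ ht) n
    have e1 : -(((n + 1 : ℕ) : ℝ) + α + β) =
        n + 1 - (2 * ((n + 1 : ℕ) : ℝ) - 2 + α + β + 2) := by push_cast; ring
    have e2 : (fun t => Htilde (n + 1) t α β) = fun t =>
        t * deriv (fun s => Real.log
          (hankelDet (invMoment β (2 * (n + 1 : ℕ) - 2 + α)) (n + 1) s)) t
          - (n + 1) * (2 * ((n + 1 : ℕ) : ℝ) - 2 + α + β + 2 - (n + 1)) := by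
      funext t
      simp only [Htilde, pjHankel_eq_hankelDet]
      push_cast
      ring
    rw [e1, e2]
    exact_mod_cast h

end PollaczekJacobi

/-! ### Quadratic substitution and splitting of the symmetric determinant -/

namespace PollaczekJacobi

open MeasureTheory Set Polynomial

/-- The Hankel determinant is unchanged by the reflection `x ↦ 1 - x` of the basis. -/
theorem det_one_sub_pow (α : ℝ) {β t : ℝ} (hβ : -1 < β) (ht : 0 < t) (n : ℕ) :
    (Matrix.of fun i j : Fin n =>
      ∫ x in (0 : ℝ)..1, (1 - x) ^ ((i : ℕ) + j) * pjWeight α β t x).det = pjHankel α β n t := by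
  have hint : ∀ k, IntervalIntegrable (fun x : ℝ => x ^ k * pjWeight α β t x) volume 0 1 :=
    fun k => ((intervalIntegrable_iff_integrableOn_Ioc_of_le zero_le_one).2
      (integrableOn_pjWeight α hβ ht)).continuousOn_mul (by fun_prop)
  have hL : ∀ q : ℝ[X], IntervalIntegrable (fun x => q.eval x * pjWeight α β t x) volume 0 1 ∧
      momentFunctional (fun k => pjMoment α β k t) q =
        ∫ x in (0 : ℝ)..1, q.eval x * pjWeight α β t x := by
    intro q
    induction q using Polynomial.induction_on' with
    | add p q hp hq =>
      simp only [eval_add, add_mul, map_add]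
      exact ⟨hp.1.add hq.1, by rw [intervalIntegral.integral_add hp.1 hq.1, hp.2, hq.2]⟩
    | monomial k a =>
      simp only [eval_monomial, mul_assoc, intervalIntegral.integral_const_mul]
      refine ⟨(hint k).const_mul a, ?_⟩
      rw [← C_mul_X_pow_eq_monomial, ← smul_eq_C_mul, map_smul, momentFunctional_X_pow, smul_eq_mul,
        pjMoment]
  rw [pjHankel, ← det_gram_eq_det_hankel (fun k => pjMoment α β k t) n (fun i => (X - C 1) ^ i)
    (fun i => (monic_X_sub_C 1).pow i)
    (fun i => by rw [(monic_X_sub_C (1 : ℝ)).natDegree_pow, natDegree_X_sub_C, mul_one])]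
  -- The powers of 1 - x are not monic; their signs factor out of rows and columns, and each occurs
  -- twice.
  have h : ∀ i j : Fin n, ∫ x in (0 : ℝ)..1, (1 - x) ^ ((i : ℕ) + j) * pjWeight α β t x =
      (-1) ^ (i : ℕ) * ((-1) ^ (j : ℕ) *
        momentFunctional (fun k => pjMoment α β k t) ((X - C 1) ^ (i : ℕ) * (X - C 1) ^ (j : ℕ))) := by
    intro i j
    rw [(hL _).2, ← intervalIntegral.integral_const_mul, ← intervalIntegral.integral_const_mul]
    congr 1
    funext x
    simp only [eval_mul, eval_pow, eval_sub, eval_X, eval_C]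
    rw [← neg_sub x 1, neg_pow, pow_add, pow_add]
    ring
  simp only [h]
  have e := Matrix.det_mul_column (fun i : Fin n => (-1 : ℝ) ^ (i : ℕ))
    (Matrix.of fun i j : Fin n => (-1) ^ (j : ℕ) *
        momentFunctional (fun k => pjMoment α β k t) ((X - C 1) ^ (i : ℕ) * (X - C 1) ^ (j : ℕ)))
  simp only [Matrix.of_apply] at e
  rw [e]
  have e' := Matrix.det_mul_row (fun i : Fin n => (-1 : ℝ) ^ (i : ℕ))
    (Matrix.of fun i j : Fin n =>
        momentFunctional (fun k => pjMoment α β k t) ((X - C 1) ^ (i : ℕ) * (X - C 1) ^ (j : ℕ)))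
  simp only [Matrix.of_apply] at e'
  rw [e', ← mul_assoc, ← Finset.prod_mul_distrib]
  simp [← mul_pow]

theorem symMoment_odd (α : ℝ) {k : ℕ} (hk : Odd k) (t : ℝ) : symMoment α k t = 0 := by
  have h := intervalIntegral.integral_comp_neg (a := -1) (b := 1)
    (fun x => x ^ k * symWeight α t x)
  have e : ∀ x : ℝ, (-x) ^ k * symWeight α t (-x) = -(x ^ k * symWeight α t x) := fun x => by
    simp only [symWeight, hk.neg_pow, neg_sq]; ring
  simp only [e, neg_neg, intervalIntegral.integral_neg] at h
  unfold symMoment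
  linarith

theorem setIntegral_Ioo_one_sub_sq (g : ℝ → ℝ) :
    ∫ x in Ioo (0 : ℝ) 1, g x = ∫ u in Ioo (0 : ℝ) 1, 2 * u * g (1 - u ^ 2) := by
  have himg : (fun u : ℝ => 1 - u ^ 2) '' Ioo 0 1 = Ioo 0 1 := by
    ext x
    constructor
    · rintro ⟨u, hu, rfl⟩
      have h1 := hu.1
      have h2 := hu.2
      exact ⟨by nlinarith, by nlinarith⟩
    · intro hx
      refine ⟨√(1 - x), ⟨Real.sqrt_pos.2 (by linarith [hx.2]), ?_⟩, ?_⟩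
      · rw [Real.sqrt_lt' one_pos]; linarith [hx.1]
      · simp only [Real.sq_sqrt (by linarith [hx.2] : 0 ≤ 1 - x)]; ring
  have hinj : InjOn (fun u : ℝ => 1 - u ^ 2) (Ioo 0 1) := by
    intro u hu v hv h
    have h' : u ^ 2 = v ^ 2 := by simp only at h; linarith
    exact (pow_left_inj₀ hu.1.le hv.1.le two_ne_zero).1 h'
  have h := integral_image_eq_integral_abs_deriv_smul (s := Ioo (0 : ℝ) 1)
    (f := fun u : ℝ => 1 - u ^ 2) (f' := fun u => -(2 * u)) measurableSet_Ioo
    (fun u _ => by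
      simpa using ((hasDerivAt_pow 2 u).const_sub 1).hasDerivWithinAt) hinj g
  rw [himg] at h
  rw [h]
  refine setIntegral_congr_fun measurableSet_Ioo fun u hu => ?_
  have := hu.1
  simp only [smul_eq_mul, abs_neg, abs_of_pos (mul_pos two_pos this)]

theorem intervalIntegrable_symWeight {α t : ℝ} (k : ℕ) (ht : 0 < t) :
    IntervalIntegrable (fun x => x ^ k * symWeight α t x) volume (-1) 1 := by
  obtain ⟨K, hK⟩ := exists_rpow_mul_exp_le α ht
  refine (intervalIntegrable_iff_integrableOn_Ioo_of_le (by norm_num)).2 ?_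
  refine (integrableOn_const (C := K) (by simp)).mono' ?_ ?_
  · unfold symWeight
    exact (by fun_prop : Measurable _).aestronglyMeasurable
  · refine (ae_restrict_iff' measurableSet_Ioo).2 (ae_of_all _ fun x hx => ?_)
    have h0 : 0 < 1 - x ^ 2 := by nlinarith [hx.1, hx.2]
    have h1 := hK (1 - x ^ 2) ⟨h0, by nlinarith [sq_nonneg x]⟩
    have h2 : |x ^ k| ≤ 1 := by
      rw [abs_pow]; exact pow_le_one₀ (abs_nonneg x) (abs_le.2 ⟨hx.1.le, hx.2.le⟩)
    have h3 : 0 ≤ (1 - x ^ 2) ^ α * Real.exp (-t / (1 - x ^ 2)) := by positivity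
    rw [norm_mul, Real.norm_eq_abs, symWeight, Real.norm_of_nonneg h3]
    exact (mul_le_of_le_one_left h3 h2).trans h1

/-- Under x = 1 - u² the Jacobian 2u meets (1-x)^(-1/2) = 1/u, leaving the factor 2 of the two
symmetric halves. -/
theorem symMoment_even (α : ℝ) (k : ℕ) {t : ℝ} (ht : 0 < t) :
    symMoment α (2 * k) t =
      ∫ x in (0 : ℝ)..1, (1 - x) ^ k * pjWeight α (-1 / 2) t x := by
  have hi := intervalIntegrable_symWeight (α := α) (2 * k) ht
  have h0 : (0 : ℝ) ∈ uIcc (-1) 1 := by rw [uIcc_of_le (by norm_num)]; norm_num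
  have hi1 := hi.mono_set (uIcc_subset_uIcc left_mem_uIcc h0)
  have hi2 := hi.mono_set (uIcc_subset_uIcc h0 right_mem_uIcc)
  have hneg := intervalIntegral.integral_comp_neg (a := 0) (b := 1)
    (fun x => x ^ (2 * k) * symWeight α t x)
  have e : ∀ x : ℝ, (-x) ^ (2 * k) * symWeight α t (-x) = x ^ (2 * k) * symWeight α t x :=
    fun x => by simp only [symWeight, (even_two_mul k).neg_pow, neg_sq]
  simp only [e, neg_zero] at hneg
  rw [symMoment, ← intervalIntegral.integral_add_adjacent_intervals hi1 hi2, ← hneg, ← two_mul,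
    ← intervalIntegral.integral_const_mul, intervalIntegral.integral_of_le zero_le_one,
    intervalIntegral.integral_of_le zero_le_one, integral_Ioc_eq_integral_Ioo,
    integral_Ioc_eq_integral_Ioo, setIntegral_Ioo_one_sub_sq fun x => _ * pjWeight _ _ _ x]
  refine setIntegral_congr_fun measurableSet_Ioo fun u hu => ?_
  have hu0 := hu.1
  have h1 : (u ^ 2) ^ (-1 / 2 : ℝ) = u⁻¹ := by
    rw [← Real.rpow_natCast, ← Real.rpow_mul hu0.le, ← Real.rpow_neg_one]
    norm_num
  simp only [symWeight, pjWeight, sub_sub_cancel, h1]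
  field_simp
  ring

theorem symMoment_even_succ (α : ℝ) (k : ℕ) {t : ℝ} (ht : 0 < t) :
    symMoment α (2 * (k + 1)) t =
      ∫ x in (0 : ℝ)..1, (1 - x) ^ k * pjWeight α (1 / 2) t x := by
  rw [symMoment_even α (k + 1) ht, intervalIntegral.integral_of_le zero_le_one,
    intervalIntegral.integral_of_le zero_le_one, integral_Ioc_eq_integral_Ioo,
    integral_Ioc_eq_integral_Ioo]
  refine setIntegral_congr_fun measurableSet_Ioo fun x hx => ?_
  have h : 0 < 1 - x := by linarith [hx.2]
  simp only [pjWeight]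
  rw [show (1 / 2 : ℝ) = -1 / 2 + 1 by norm_num, Real.rpow_add_one h.ne']
  ring

/-- Splitting of the indices `0, …, N - 1` into even and odd ones. -/
theorem exists_evenOddEquiv {a b N : ℕ} (h1 : N = a + b) (h2 : a = b ∨ a = b + 1) :
    ∃ e : Fin a ⊕ Fin b ≃ Fin N, (∀ i, (e (Sum.inl i) : ℕ) = 2 * i) ∧
      ∀ j, (e (Sum.inr j) : ℕ) = 2 * j + 1 := by
  let f : Fin a ⊕ Fin b → Fin N := Sum.elim (fun i => ⟨2 * i, by omega⟩)
    (fun j => ⟨2 * j + 1, by omega⟩)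
  have hf : Function.Bijective f := by
    rw [Fintype.bijective_iff_injective_and_card]
    refine ⟨?_, by simp [h1]⟩
    rintro (i | i) (j | j) h <;> simp only [f, Sum.elim_inl, Sum.elim_inr, Fin.mk.injEq] at h
    · congr 1; ext; omega
    · omega
    · omega
    · congr 1; ext; omega
  exact ⟨Equiv.ofBijective f hf, fun i => rfl, fun j => rfl⟩

/-- Ordering even indices before odd ones makes the matrix block diagonal. Odd indices sum to
2(i+j+1); the extra factor 1 - x raises β from -1/2 to 1/2. -/
theorem symHankel_eq_mul (α : ℝ) {a b N : ℕ} (h1 : N = a + b) (h2 : a = b ∨ a = b + 1) {t : ℝ}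
    (ht : 0 < t) :
    symHankel α N t = pjHankel α (-1 / 2) a t * pjHankel α (1 / 2) b t := by
  obtain ⟨e, he1, he2⟩ := exists_evenOddEquiv h1 h2
  rw [← det_one_sub_pow α (by norm_num) ht, ← det_one_sub_pow α (by norm_num) ht,
    ← Matrix.det_fromBlocks_zero₂₁ _ 0, symHankel, ← Matrix.det_submatrix_equiv_self e]
  congr 1
  ext (i | i) (j | j)
  · simp only [Matrix.submatrix_apply, Matrix.of_apply, Matrix.fromBlocks_apply₁₁, he1]
    rw [← mul_add, symMoment_even α _ ht]
  · simp only [Matrix.submatrix_apply, Matrix.of_apply, Matrix.fromBlocks_apply₁₂, he1, he2,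
      Matrix.zero_apply]
    exact symMoment_odd α ⟨i + j, by ring⟩ t
  · simp only [Matrix.submatrix_apply, Matrix.of_apply, Matrix.fromBlocks_apply₂₁, he1, he2,
      Matrix.zero_apply]
    exact symMoment_odd α ⟨i + j, by ring⟩ t
  · simp only [Matrix.submatrix_apply, Matrix.of_apply, Matrix.fromBlocks_apply₂₂, he2]
    rw [← symMoment_even_succ α _ ht]
    congr 1
    ring

theorem exists_symHankel_eq_mul (α : ℝ) (N : ℕ) : ∃ a b : ℕ, ∀ t, 0 < t →
    symHankel α N t = pjHankel α (-1 / 2) a t * pjHankel α (1 / 2) b t :=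
  ⟨N - N / 2, N / 2, fun _ ht => symHankel_eq_mul α (by omega) (by omega) ht⟩

theorem symHankel_pos (α : ℝ) (N : ℕ) {t : ℝ} (ht : 0 < t) : 0 < symHankel α N t := by
  obtain ⟨a, b, h⟩ := exists_symHankel_eq_mul α N
  rw [h t ht]
  exact mul_pos (pjHankel_pos α (by norm_num) a ht) (pjHankel_pos α (by norm_num) b ht)

theorem differentiableAt_symHankel (α : ℝ) (N : ℕ) {t : ℝ} (ht : 0 < t) :
    DifferentiableAt ℝ (symHankel α N) t := by
  obtain ⟨a, b, h⟩ := exists_symHankel_eq_mul α N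
  refine ((differentiableAt_pjHankel α (β := -1 / 2) (by norm_num) a ht).fun_mul
    (differentiableAt_pjHankel α (β := 1 / 2) (by norm_num) b ht)).congr_of_eventuallyEq ?_
  filter_upwards [lt_mem_nhds ht] with s hs using h s hs

theorem sigma_eq (α : ℝ) {a b N : ℕ} (h1 : N = a + b) (h2 : a = b ∨ a = b + 1) {t : ℝ}
    (ht : 0 < t) :
    sigma α N t = 2 * (Htilde a t α (-1 / 2) + a * (a + α + -1 / 2))
      + 2 * (Htilde b t α (1 / 2) + b * (b + α + 1 / 2)) := by
  have ha : ∀ s, 0 < s → 0 < pjHankel α (-1 / 2) a s := fun s => pjHankel_pos α (by norm_num) a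
  have hb : ∀ s, 0 < s → 0 < pjHankel α (1 / 2) b s := fun s => pjHankel_pos α (by norm_num) b
  have hd : deriv (fun s => Real.log (symHankel α N s)) t =
      deriv (fun s => Real.log (pjHankel α (-1 / 2) a s)) t
        + deriv (fun s => Real.log (pjHankel α (1 / 2) b s)) t := by
    have e1 := ((differentiableAt_pjHankel α (by norm_num) a ht).log (ha t ht).ne').hasDerivAt
    have e2 := ((differentiableAt_pjHankel α (by norm_num) b ht).log (hb t ht).ne').hasDerivAt
    refine ((e1.fun_add e2).congr_of_eventuallyEq ?_).deriv
    filter_upwards [lt_mem_nhds ht] with s hs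
    rw [symHankel_eq_mul α h1 h2 hs, Real.log_mul (ha s hs).ne' (hb s hs).ne']
  rw [sigma, hd, Htilde, Htilde]
  ring

end PollaczekJacobi

theorem mainTheorem6 (α : ℝ) (hα : 0 < α) :
    (∀ (n : ℕ) (t : ℝ), 0 < t →
      0 < PollaczekJacobi.symHankel α n t ∧
      DifferentiableAt ℝ (PollaczekJacobi.symHankel α n) t) ∧
    (∀ β : ℝ, -1 < β → ∀ (n : ℕ) (t : ℝ), 0 < t →
      0 < PollaczekJacobi.pjHankel α β n t ∧
      DifferentiableAt ℝ (PollaczekJacobi.pjHankel α β n) t) ∧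
    (∀ (n : ℕ) (t : ℝ), 0 < t →
      PollaczekJacobi.sigma α (2 * n) t =
        2 * PollaczekJacobi.Htilde n t α (1 / 2) + 2 * PollaczekJacobi.Htilde n t α (-1 / 2)
          + 4 * n * (n + α)) ∧
    (∀ (n : ℕ) (t : ℝ), 0 < t →
      PollaczekJacobi.sigma α (2 * n + 1) t =
        2 * PollaczekJacobi.Htilde n t α (1 / 2) + 2 * PollaczekJacobi.Htilde (n + 1) t α (-1 / 2)
          + (2 * n + 1) * (2 * n + 1 + 2 * α)) ∧
    (∀ β : ℝ, -1 < β → ∀ n : ℕ,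
      PollaczekJacobi.IsSigmaPainleveV 0 (-(n + α + β)) n (-β)
        (fun t => PollaczekJacobi.Htilde n t α β)) := by
  refine ⟨fun n t ht => ⟨PollaczekJacobi.symHankel_pos α n ht,
      PollaczekJacobi.differentiableAt_symHankel α n ht⟩,
    fun β hβ n t ht => ⟨PollaczekJacobi.pjHankel_pos α hβ n ht,
      PollaczekJacobi.differentiableAt_pjHankel α hβ n ht⟩,
    fun n t ht => ?_, fun n t ht => ?_,
    fun β hβ n => PollaczekJacobi.isSigmaPainleveV_Htilde α hβ n⟩
  · rw [PollaczekJacobi.sigma_eq α (two_mul n) (Or.inl rfl) ht]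
    ring
  · rw [PollaczekJacobi.sigma_eq α (show 2 * n + 1 = (n + 1) + n by omega) (Or.inr rfl) ht]
    push_cast
    ring
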